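/- Let $\omega\in(0,1)$ and let $(a_j)_{j\ge1}$, $(b_j)_{j\ge1}$ be sequences of positive real numbers with $a_1\le a_2\le\cdots$, $a_*:=\inf_j a_j=a_1>0$ and $\inf_j b_j>0$. For $s\in\mathbb N=\{1,2,\dots\}$ and $\boldsymbol h\in\mathbb Z^s$ put $\omega_{\boldsymbol h}=\omega^{\sum_{j=1}^s a_j|h_j|^{b_j}}$, and let $H_s$ be the reproducing kernel Hilbert space of complex-valued functions on $[0,1]^s$ with kernel $$K_s(\boldsymbol x,\boldsymbol y)=\sum_{\boldsymbol h\in\mathbb Z^s}\omega_{\boldsymbol h}\exp\big(2\pi \mathrm i\,\boldsymbol h\cdot(\boldsymbol x-\boldsymbol y)\big).$$ For a finite set $\mathcal P\subset[0,1]^s$ and $f\in H_s$ let $\sigma(f;\mathcal P)$ be the spline, that is, the element $g\in H_s$ of minimal norm with $g(\boldsymbol x)=f(\boldsymbol x)$ for all $\boldsymbol x\in\mathcal P$, and let $$e(H_s,\mathcal P)=\sup_{f\in H_s,\ \|f\|_{H_s}\le1}\|f-\sigma(f;\mathcal P)\|_{L_\infty([0,1]^s)}$$ be the worst-case error of the spline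 algorithm. Assume that $$B:=\sum_{j=1}^\infty\frac1{b_j}<\infty\quad\text{and}\quad \alpha^*:=\liminf_{j\to\infty}\frac{\log a_j}{j}\in(0,\infty]$$ and let $\beta\in(0,1)$. For $s\in\mathbb N$ and $\varepsilon\in(0,1)$ let $$m_j=2\left\lceil\left(\frac{\log\varepsilon^{-2}}{a_j^\beta\log\omega^{-1}}\right)^{1/b_j}\right\rceil-1,\qquad j=1,\dots,s,$$ and let $\mathcal G^*_{n,s}=\{(k_1/m_1,\dots,k_s/m_s):\ k_j\in\{0,1,\dots,m_j-1\},\ j=1,\dots,s\}$ be the regular grid with these mesh-sizes, which has $n=\prod_{j=1}^s m_j$ points. Then: (i) for every $\eta\in(0,\min(a_*^{1-\beta},1))$ and every $\delta\in(0,\alpha^*)$ there is a constant $\overline C_{\beta,\delta,\eta}>0$ such that for all $s\in\mathbb N$ and all $\varepsilon\in(0,1)$ $$e(H_s,\mathcal G^*_{n,s})\le\overline C_{\beta,\delta,\eta}\;\varepsilon^{\min(a_*^{1-\beta},1)-\eta};$$ (ii) for every $\delta\in(0,\alpha^*)$ there is a constant $C_{\beta,\delta}>0$ such that for all $s\in\mathbb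 N$ and all $\varepsilon\in(0,1)$ $$n\le C_{\beta,\delta}\,\big(1+\log\varepsilon^{-1}\big)^{B+(\log3)/(\beta\delta)}.$$ The constants do not depend on $s$ and $\varepsilon$; they may depend on the fixed data $\omega$, $(a_j)$, $(b_j)$ and on the parameters in their indices. -/

import Mathlib

open MeasureTheory Filter
open scoped ENNReal InnerProductSpace

/-! ### Weights -/

/-- The parameters of the weighted Korobov space: `ω ∈ (0,1)` and two sequences of positive
weights with positive infimum, the first of which is nondecreasing. The sequences are indexed
from `0`, so that `a j` and `b j` stand for the weights usually written with the index `j + 1`. -/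
structure KorobovWeights where
  /-- the sequence `a` -/
  a : ℕ → ℝ
  /-- the sequence `b` -/
  b : ℕ → ℝ
  /-- the base `ω` -/
  ω : ℝ
  a_pos : ∀ j, 0 < a j
  b_pos : ∀ j, 0 < b j
  a_inf_pos : 0 < ⨅ j, a j
  b_inf_pos : 0 < ⨅ j, b j
  a_mono : Monotone a
  ω_pos : 0 < ω
  ω_lt_one : ω < 1

/-- The unit cube `[0,1]^s`; its `volume` is the Lebesgue measure. -/
abbrev UnitCube (s : ℕ) : Type := Fin s → unitInterval

/-! ### Splines in a reproducing kernel Hilbert space of complex-valued functions -/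

section Spline

variable {X H : Type*} [NormedAddCommGroup H] [InnerProductSpace ℂ H] [RKHS ℂ H X ℂ]

/-- `g` has minimal norm among all elements of `H` that agree with `f` on `P`. -/
def IsSpline (P : Set X) (f g : H) : Prop :=
  (∀ x ∈ P, g x = f x) ∧ ∀ g' : H, (∀ x ∈ P, g' x = f x) → ‖g‖ ≤ ‖g'‖

/-- The interpolant of minimal norm exists and is unique. -/
theorem existsUnique_isSpline [CompleteSpace H] (P : Set X) (f : H) :
    ∃! g : H, IsSpline P f g := by
  let N : Submodule ℂ H :=
    { carrier := {g | ∀ x ∈ P, g x = 0}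
      add_mem' := fun {u v} hu hv x hx => by
        simp [hu x hx, hv x hx]
      zero_mem' := fun x _ => by simp
      smul_mem' := fun c u hu x hx => by simp [hu x hx] }
  have hNmem : ∀ u : H, u ∈ N ↔ ∀ x ∈ P, u x = 0 := fun u => Iff.rfl
  have hclosed : IsClosed (N : Set H) := by
    have : (N : Set H) = ⋂ x ∈ P, {g : H | g x = 0} := by
      ext g
      simp only [SetLike.mem_coe, hNmem, Set.mem_iInter, Set.mem_ofPred_eq]
    rw [this]
    exact isClosed_biInter fun x _ =>
      isClosed_eq (RKHS.continuous_eval (𝕜 := ℂ) x) continuous_const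
  have : CompleteSpace N := hclosed.isComplete.completeSpace_coe
  -- every interpolant is the spline plus an element of the orthogonal space `N`
  let p : H := N.starProjection f
  have hp : p ∈ N := N.starProjection_apply_mem f
  have horth : f - p ∈ Nᗮ := N.sub_starProjection_mem_orthogonal f
  have hpyth : ∀ g' : H, (∀ x ∈ P, g' x = f x) →
      ‖g'‖ ^ 2 = ‖f - p‖ ^ 2 + ‖g' - (f - p)‖ ^ 2 := by
    intro g' hg'
    have hmem : g' - (f - p) ∈ N := by
      intro x hx
      have := (hNmem p).1 hp x hx
      simp [hg' x hx, this]
    have h0 : ⟪f - p, g' - (f - p)⟫_ℂ = 0 := Submodule.inner_left_of_mem_orthogonal hmem horth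
    have := norm_add_sq_eq_norm_sq_add_norm_sq_of_inner_eq_zero (𝕜 := ℂ) _ _ h0
    rw [add_sub_cancel] at this
    simpa [sq] using this
  have hint : ∀ x ∈ P, (f - p) x = f x := by
    intro x hx
    have := (hNmem p).1 hp x hx
    simp [this]
  refine ⟨f - p, ⟨hint, fun g' hg' => ?_⟩, fun g hg => ?_⟩
  · have := hpyth g' hg'
    nlinarith [norm_nonneg (f - p), norm_nonneg g', sq_nonneg ‖g' - (f - p)‖]
  · have h1 := hpyth g hg.1
    have h2 := hg.2 (f - p) hint
    have h3 : ‖g - (f - p)‖ ^ 2 ≤ 0 := by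
      nlinarith [norm_nonneg (f - p), norm_nonneg g]
    have h4 : ‖g - (f - p)‖ = 0 := by
      nlinarith [norm_nonneg (g - (f - p)), sq_nonneg ‖g - (f - p)‖]
    exact sub_eq_zero.1 (norm_eq_zero.1 h4)

/-- The spline `σ(f; P)`: the element of minimal norm that agrees with `f` on `P`. -/
noncomputable def spline [CompleteSpace H] (P : Set X) (f : H) : H :=
  (existsUnique_isSpline P f).choose

/-- The spline has the property that defines it. -/
theorem isSpline_spline [CompleteSpace H] (P : Set X) (f : H) : IsSpline P f (spline P f) :=
  (existsUnique_isSpline P f).choose_spec.1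

end Spline

/-! ### Regular grids -/

/-- The regular grid of all `(k₁/m₁, …, k_s/m_s)` with `0 ≤ k_j < m_j`. -/
def regularGrid {s : ℕ} (m : Fin s → ℕ) : Set (UnitCube s) :=
  {x | ∀ j, ∃ k : ℕ, k < m j ∧ (x j : ℝ) = (k : ℝ) / (m j : ℝ)}

/-- The regular grid with mesh-sizes `m₁, …, m_s` has `m₁ ⋯ m_s` points. -/
theorem ncard_regularGrid {s : ℕ} (m : Fin s → ℕ) : (regularGrid m).ncard = ∏ j, m j := by
  have hI : ∀ (j : Fin s) (k : Fin (m j)), (k : ℝ) / (m j : ℝ) ∈ unitInterval := fun j k =>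
    ⟨by positivity, div_le_one_of_le₀ (by exact_mod_cast k.2.le) (by positivity)⟩
  let F : (∀ j, Fin (m j)) → UnitCube s := fun k j => ⟨(k j : ℝ) / (m j : ℝ), hI j (k j)⟩
  have hF : Function.Injective F := by
    intro k l hkl
    funext j
    have h := congrArg Subtype.val (congrFun hkl j)
    have hm : (m j : ℝ) ≠ 0 := by
      have := (k j).2
      exact_mod_cast (by omega : m j ≠ 0)
    have h' : ((k j : ℕ) : ℝ) / (m j : ℝ) = ((l j : ℕ) : ℝ) / (m j : ℝ) := h
    rw [div_left_inj' hm] at h'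
    exact Fin.ext (by exact_mod_cast h')
  have hr : regularGrid m = Set.range F := by
    ext x
    constructor
    · intro hx
      choose k hk hxk using hx
      exact ⟨fun j => ⟨k j, hk j⟩, funext fun j => Subtype.ext (hxk j).symm⟩
    · rintro ⟨k, rfl⟩ j
      exact ⟨k j, (k j).2, rfl⟩
  rw [hr, ← Nat.card_coe_set_eq, Nat.card_range_of_injective hF]
  simp [Nat.card_eq_fintype_card]

namespace KorobovWeights

variable (w : KorobovWeights)

/-- `a_* = inf_j a_j`. -/
noncomputable def aStar : ℝ := ⨅ j, w.a j

/-- `B = ∑_j 1 / b_j` (meaningful if this series converges). -/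
noncomputable def B : ℝ := ∑' j, 1 / w.b j

/-- `α^* = liminf_j (log a_j) / j`, an extended real number. -/
noncomputable def alphaStar : EReal :=
  liminf (fun j : ℕ => ((Real.log (w.a j) / ((j : ℝ) + 1) : ℝ) : EReal)) atTop

/-! ### The Korobov space -/

/-- `ω_h = ω ^ (∑_j a_j |h_j| ^ b_j)` for `h ∈ ℤ^s`. -/
noncomputable def omega {s : ℕ} (h : Fin s → ℤ) : ℝ :=
  w.ω ^ (∑ j : Fin s, w.a j * |(h j : ℝ)| ^ w.b j)

/-- The kernel `K(x, y) = ∑_{h ∈ ℤ^s} ω_h exp(2π i h ⋅ (x - y))`. -/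
noncomputable def kernel {s : ℕ} (x y : UnitCube s) : ℂ :=
  ∑' h : Fin s → ℤ, (w.omega h : ℂ) *
    Complex.exp (2 * Real.pi * Complex.I * ∑ j, (h j : ℂ) * (((x j : ℝ) : ℂ) - ((y j : ℝ) : ℂ)))

/-- The kernel as a matrix of operators on `ℂ`: the entry at `(x, y)` is the multiplication
by `K(x, y)`. -/
noncomputable def kernelMatrix (s : ℕ) : Matrix (UnitCube s) (UnitCube s) (ℂ →L[ℂ] ℂ) :=
  Matrix.of fun x y => w.kernel x y • (1 : ℂ →L[ℂ] ℂ)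

theorem omega_pos {s : ℕ} (h : Fin s → ℤ) : 0 < w.omega h := Real.rpow_pos_of_pos w.ω_pos _

/-- The factorization `exp(2π i h ⋅ (x - y)) = e_h(x) * conj (e_h(y))`. -/
theorem exp_factor {s : ℕ} (h : Fin s → ℤ) (x y : UnitCube s) :
    Complex.exp (2 * Real.pi * Complex.I * ∑ j, (h j : ℂ) * (((x j : ℝ) : ℂ) - ((y j : ℝ) : ℂ))) =
      Complex.exp (2 * Real.pi * Complex.I * ∑ j, (h j : ℂ) * ((x j : ℝ) : ℂ)) *
        (starRingEnd ℂ)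
          (Complex.exp (2 * Real.pi * Complex.I * ∑ j, (h j : ℂ) * ((y j : ℝ) : ℂ))) := by
  rw [← Complex.exp_conj, ← Complex.exp_add]
  congr 1
  simp only [map_mul, map_sum, Complex.conj_I, Complex.conj_ofReal, map_ofNat, mul_sub,
    Finset.sum_sub_distrib, map_intCast]
  ring

theorem norm_exp_factor {s : ℕ} (h : Fin s → ℤ) (x y : UnitCube s) :
    ‖Complex.exp (2 * Real.pi * Complex.I *
      ∑ j, (h j : ℂ) * (((x j : ℝ) : ℂ) - ((y j : ℝ) : ℂ)))‖ = 1 := by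
  have : (2 * Real.pi * Complex.I * ∑ j, (h j : ℂ) * (((x j : ℝ) : ℂ) - ((y j : ℝ) : ℂ)) : ℂ) =
      ((2 * Real.pi * ∑ j, (h j : ℝ) * ((x j : ℝ) - (y j : ℝ)) : ℝ) : ℂ) * Complex.I := by
    push_cast
    ring
  rw [this, Complex.norm_exp_ofReal_mul_I]

theorem conj_kernel {s : ℕ} (x y : UnitCube s) :
    (starRingEnd ℂ) (w.kernel x y) = w.kernel y x := by
  unfold kernel
  rw [Complex.conj_tsum]
  congr 1
  funext h
  rw [exp_factor h x y, exp_factor h y x]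
  simp only [map_mul, Complex.conj_ofReal, Complex.conj_conj]
  ring

/-- The kernel is positive semidefinite. -/
theorem posSemidef_kernelMatrix (s : ℕ) : (w.kernelMatrix s).PosSemidef := by
  have htfae := (RKHS.posSemidef_tfae (K := w.kernelMatrix s)).out 0 2
  refine htfae.2 ⟨?_, fun vv => ?_⟩
  · ext x y
    simp [kernelMatrix, Matrix.conjTranspose_apply, ← w.conj_kernel x y]
  by_cases hs : Summable fun h : Fin s → ℤ => w.omega h
  · let e : (Fin s → ℤ) → UnitCube s → ℂ := fun h x =>
      Complex.exp (2 * Real.pi * Complex.I * ∑ j, (h j : ℂ) * ((x j : ℝ) : ℂ))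
    have hsum : ∀ x y : UnitCube s, HasSum (fun h : Fin s → ℤ =>
        (w.omega h : ℂ) * (e h x * (starRingEnd ℂ) (e h y))) (w.kernel x y) := by
      intro x y
      have : Summable fun h : Fin s → ℤ => (w.omega h : ℂ) *
          Complex.exp (2 * Real.pi * Complex.I *
            ∑ j, (h j : ℂ) * (((x j : ℝ) : ℂ) - ((y j : ℝ) : ℂ))) := by
        refine Summable.of_norm ?_
        simpa [norm_exp_factor, abs_of_pos (w.omega_pos _)] using hs
      have h2 : HasSum _ (w.kernel x y) := this.hasSum
      simpa only [exp_factor] using h2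
    have key : HasSum (fun h : Fin s → ℤ =>
        ((w.omega h * ‖vv.sum fun x v => e h x * (starRingEnd ℂ) v‖ ^ 2 : ℝ) : ℂ))
        (vv.sum fun x v => vv.sum fun x' v' => ⟪w.kernelMatrix s x' x v, v'⟫_ℂ) := by
      have h1 : HasSum (fun h : Fin s → ℤ => ∑ x ∈ vv.support, ∑ x' ∈ vv.support,
          ((w.omega h : ℂ) * (e h x * (starRingEnd ℂ) (e h x')) * (vv x' * (starRingEnd ℂ) (vv x))))
          (∑ x ∈ vv.support, ∑ x' ∈ vv.support,
            w.kernel x x' * (vv x' * (starRingEnd ℂ) (vv x))) :=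
        hasSum_sum fun x _ => hasSum_sum fun x' _ => (hsum x x').mul_right _
      convert h1 using 1
      · funext h
        rw [Complex.ofReal_mul, Complex.ofReal_pow, ← Complex.mul_conj']
        simp only [Finsupp.sum, map_sum, map_mul, Complex.conj_conj]
        rw [Finset.sum_mul_sum]
        simp only [Finset.mul_sum]
        refine Finset.sum_congr rfl fun x _ => Finset.sum_congr rfl fun x' _ => ?_
        ring
      · simp only [Finsupp.sum]
        refine Finset.sum_congr rfl fun x _ => Finset.sum_congr rfl fun x' _ => ?_
        simp [kernelMatrix, w.conj_kernel]
        ring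
    have hre := Complex.hasSum_re key
    refine hre.nonneg fun h => ?_
    rw [Complex.ofReal_re]
    exact mul_nonneg (w.omega_pos h).le (sq_nonneg _)
  · have h0 : ∀ x y : UnitCube s, w.kernel x y = 0 := by
      intro x y
      refine tsum_eq_zero_of_not_summable fun hc => hs ?_
      have := hc.norm
      simpa [norm_exp_factor, abs_of_pos (w.omega_pos _)] using this
    simp [kernelMatrix, h0, Finsupp.sum]

instance (s : ℕ) : Fact (w.kernelMatrix s).PosSemidef := ⟨w.posSemidef_kernelMatrix s⟩

/-- The Korobov space: the reproducing kernel Hilbert space of functions `[0,1]^s → ℂ` with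
the kernel `K`. -/
abbrev KorobovSpace (s : ℕ) : Type := RKHS.OfKernel (w.kernelMatrix s)

/-! ### Approximation -/

/-- The `L_∞` worst-case error, over the unit ball of the Korobov space, of the algorithm
`f ↦ σ(f; P)` that uses the function values at the points of `P`. -/
noncomputable def splineError (s : ℕ) (P : Set (UnitCube s)) : ℝ≥0∞ :=
  ⨆ (f : w.KorobovSpace s) (_ : ‖f‖ ≤ 1),
    eLpNorm (fun x : UnitCube s => f x - spline P f x) ∞ volume

/-- The mesh-sizes `m_j = 2 ⌈(log ε⁻² / (a_j ^ β log ω⁻¹)) ^ (1 / b_j)⌉ - 1`. For `0 < ε < 1`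
the ceiling is at least `1`, so that the subtraction in `ℕ` does not truncate. -/
noncomputable def mesh (β ε : ℝ) (j : ℕ) : ℕ :=
  2 * ⌈(Real.log (ε ^ (-2 : ℤ)) / (w.a j ^ β * Real.log w.ω⁻¹)) ^ (1 / w.b j)⌉₊ - 1

/-- The regular grid in `[0,1]^s` with the mesh-sizes `m_1, …, m_s` above. -/
noncomputable def grid (β ε : ℝ) (s : ℕ) : Set (UnitCube s) :=
  regularGrid fun j : Fin s => w.mesh β ε j

end KorobovWeights

/-! Error bound. The difference `g` of `f` and its spline vanishes on the grid and has norm at most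
2. Hence `g x` is unchanged if any combination of its grid values is subtracted, so `g x = ⟪v, g⟫`
with `v` the kernel function at `x` minus a combination of kernel functions at grid points. Taking
tensor product trigonometric interpolation as the combination (`exists_gridInterpolation_coeff`)
makes every frequency in the box `|h_j| ≤ q_j` drop out of `‖v‖ ^ 2`, while by aliasing each other
frequency contributes at most `4 ω_h` (`norm_apply_sq_le_of_eq_zero`). Outside the box the choice of
mesh forces `ω_h ≤ ε ^ (2 A)` with `A = a_* ^ (1 - β)`. Spending only the power `1 - θ` of `ω_h` on
this (`omega_le_of_order_lt`) leaves `∑ ω_h ^ θ`, which is bounded uniformly in `s` because the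
`a_j` grow exponentially (`exists_tsum_omega_rpow_le`). With `θ = η / A` the rate is `A - η`.
Cardinality. A coordinate with `a_j ^ β ≥ L`, where `L = log ε⁻² / log ω⁻¹`, has mesh-size 1.
Exponential growth leaves only about `log L / (β δ)` others (`card_filter_rpow_lt_le`); rounding
costs a factor 3 in each, which gives the exponent `log 3 / (β δ)`, and the powers `1 / b_j`
multiply up to the exponent `B`. -/

/-! ### Trigonometric interpolation on regular grids -/

/-- Trigonometric interpolation of order `q` at `2 q + 1` equidistant nodes: it reproduces the
frequencies up to `q` and sends every other character to one of these, up to aliasing. -/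
theorem exists_trigInterpolation_coeff {m q : ℕ} (hm : m = 2 * q + 1) (x : ℝ) :
    ∃ c : Fin m → ℂ, ∀ h : ℤ,
      (|h| ≤ q → ∑ k, c k * Complex.exp (2 * Real.pi * Complex.I *
        ((h : ℂ) * (((k : ℕ) : ℂ) / (m : ℂ)))) =
          Complex.exp (2 * Real.pi * Complex.I * ((h : ℂ) * (x : ℂ)))) ∧
      ‖∑ k, c k * Complex.exp (2 * Real.pi * Complex.I *
        ((h : ℂ) * (((k : ℕ) : ℂ) / (m : ℂ))))‖ = 1 := by
  have hm0 : (m : ℂ) ≠ 0 := by exact_mod_cast (by omega : m ≠ 0)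
  -- The index `i` stands for the frequency `i - q`, so that `Fin m` runs through `-q, …, q`.
  let v : Fin m → ℂ := fun i =>
    Complex.exp (2 * Real.pi * Complex.I * ((((i : ℕ) : ℂ) - (q : ℂ)) / (m : ℂ)))
  have hv : Function.Injective v := by
    intro i j hij
    obtain ⟨n, hn⟩ := Complex.exp_eq_exp_iff_exists_int.1 hij
    have h1 : ((i : ℕ) : ℂ) - ((j : ℕ) : ℂ) = n * m := by
      have h2 : (2 * Real.pi * Complex.I : ℂ) *
          ((((i : ℕ) : ℂ) - (q : ℂ)) / (m : ℂ) - (((j : ℕ) : ℂ) - (q : ℂ)) / (m : ℂ) - n) = 0 := by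
        linear_combination hn
      have h3 := (mul_eq_zero.1 h2).resolve_left Complex.two_pi_I_ne_zero
      field_simp at h3
      linear_combination h3
    have h4 : ((i : ℕ) : ℤ) - ((j : ℕ) : ℤ) = n * m := by exact_mod_cast h1
    have h5 : ((i : ℕ) : ℤ) - ((j : ℕ) : ℤ) = 0 := by
      refine Int.eq_zero_of_abs_lt_dvd (m := (m : ℤ)) ⟨n, by rw [h4]; ring⟩ ?_
      have := i.2
      have := j.2
      rw [abs_lt]
      omega
    exact Fin.ext (by omega)
  let t : Fin m → ℂ := fun i =>
    Complex.exp (2 * Real.pi * Complex.I * ((((i : ℕ) : ℂ) - (q : ℂ)) * (x : ℂ)))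
  have hdet : IsUnit (Matrix.vandermonde v).det :=
    (Matrix.det_vandermonde_ne_zero_iff.2 hv).isUnit
  -- Reproducing the `m` frequencies at `x` is a square Vandermonde system with distinct nodes.
  let c : Fin m → ℂ := (Matrix.vandermonde v)⁻¹.mulVec t
  have hc : ∀ i : Fin m, ∑ k : Fin m, c k * v i ^ (k : ℕ) = t i := by
    intro i
    have : (Matrix.vandermonde v).mulVec c = t := by
      rw [Matrix.mulVec_mulVec, Matrix.mul_nonsing_inv _ hdet, Matrix.one_mulVec]
    rw [← congrFun this i]
    simp [Matrix.mulVec, dotProduct, Matrix.vandermonde_apply, mul_comm]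
  -- Aliasing: frequencies congruent modulo `m` coincide on the grid.
  have hnode : ∀ (h : ℤ) (i : Fin m), (m : ℤ) ∣ h + q - (i : ℕ) → ∀ k : Fin m,
      Complex.exp (2 * Real.pi * Complex.I * ((h : ℂ) * (((k : ℕ) : ℂ) / (m : ℂ)))) =
        v i ^ (k : ℕ) := by
    rintro h i ⟨n, hn⟩ k
    rw [← Complex.exp_nat_mul, Complex.exp_eq_exp_iff_exists_int]
    refine ⟨n * (k : ℕ), ?_⟩
    have hh : (h : ℂ) = m * n - q + ((i : ℕ) : ℂ) := by
      have : h = m * n - q + (i : ℕ) := by omega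
      exact_mod_cast congrArg (Int.cast : ℤ → ℂ) this
    have hk : (h : ℂ) * (((k : ℕ) : ℂ) / (m : ℂ)) =
        ((k : ℕ) : ℂ) * ((((i : ℕ) : ℂ) - (q : ℂ)) / (m : ℂ)) + n * ((k : ℕ) : ℂ) := by
      rw [hh]
      field_simp
      ring
    rw [hk]
    push_cast
    ring
  refine ⟨c, fun h => ⟨fun hh => ?_, ?_⟩⟩
  · rw [abs_le] at hh
    have hlt : (h + q).toNat < m := by omega
    have := hc ⟨(h + q).toNat, hlt⟩
    rw [Finset.sum_congr rfl fun k _ => by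
      rw [hnode h ⟨(h + q).toNat, hlt⟩ (by simp only; rw [Int.toNat_of_nonneg (by omega)]; simp) k],
      this]
    have hcast : (((h + q).toNat : ℕ) : ℂ) = h + q := by
      have : (((h + q).toNat : ℕ) : ℤ) = h + q := Int.toNat_of_nonneg (by omega)
      exact_mod_cast congrArg (Int.cast : ℤ → ℂ) this
    simp only [t, hcast, add_sub_cancel_right]
  · have hmpos : (0 : ℤ) < m := by omega
    have hnn := Int.emod_nonneg (h + q) hmpos.ne'
    have hlt : ((h + q) % m).toNat < m := by
      have := Int.emod_lt_of_pos (h + q) hmpos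
      omega
    have := hc ⟨((h + q) % m).toNat, hlt⟩
    rw [Finset.sum_congr rfl fun k _ => by
      rw [hnode h ⟨((h + q) % m).toNat, hlt⟩
        (by simp only; rw [Int.toNat_of_nonneg hnn]; exact Int.dvd_self_sub_emod) k], this]
    have harg : (2 * Real.pi * Complex.I * ((((((h + q) % m).toNat : ℕ) : ℂ) - (q : ℂ)) * (x : ℂ)))
        = ((2 * Real.pi * (((((h + q) % m).toNat : ℕ) : ℝ) - q) * x : ℝ) : ℂ) * Complex.I := by
      push_cast
      ring
    simp only [t, harg, Complex.norm_exp_ofReal_mul_I]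

namespace KorobovWeights

/-- The character `x ↦ exp(2π i h ⋅ x)`. -/
noncomputable def character {s : ℕ} (h : Fin s → ℤ) (x : UnitCube s) : ℂ :=
  Complex.exp (2 * Real.pi * Complex.I * ∑ j, (h j : ℂ) * ((x j : ℝ) : ℂ))

theorem norm_character {s : ℕ} (h : Fin s → ℤ) (x : UnitCube s) : ‖character h x‖ = 1 := by
  have : (2 * Real.pi * Complex.I * ∑ j, (h j : ℂ) * ((x j : ℝ) : ℂ) : ℂ) =
      ((2 * Real.pi * ∑ j, (h j : ℝ) * (x j : ℝ) : ℝ) : ℂ) * Complex.I := by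
    push_cast
    ring
  rw [character, this, Complex.norm_exp_ofReal_mul_I]

theorem character_eq_prod {s : ℕ} (h : Fin s → ℤ) (x : UnitCube s) :
    character h x =
      ∏ j, Complex.exp (2 * Real.pi * Complex.I * ((h j : ℂ) * ((x j : ℝ) : ℂ))) := by
  rw [character, Finset.mul_sum, Complex.exp_sum]

/-- The points of the regular grid with mesh-sizes `2 q_j + 1`, indexed by their numerators. -/
noncomputable def gridPoint {s : ℕ} (q : Fin s → ℕ) (k : ∀ j, Fin (2 * q j + 1)) : UnitCube s :=
  fun j => ⟨((k j : ℕ) : ℝ) / ((2 * q j + 1 : ℕ) : ℝ), by positivity,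
    div_le_one_of_le₀ (by exact_mod_cast (k j).2.le) (by positivity)⟩

theorem gridPoint_mem {s : ℕ} (q : Fin s → ℕ) (k : ∀ j, Fin (2 * q j + 1)) :
    gridPoint q k ∈ regularGrid fun j => 2 * q j + 1 :=
  fun j => ⟨k j, (k j).2, rfl⟩

/-- Tensor product trigonometric interpolation on a regular grid. -/
theorem exists_gridInterpolation_coeff {s : ℕ} (q : Fin s → ℕ) (x : UnitCube s) :
    ∃ c : (∀ j, Fin (2 * q j + 1)) → ℂ, ∀ h : Fin s → ℤ,
      ((∀ j, |h j| ≤ q j) → ∑ k, c k * character h (gridPoint q k) = character h x) ∧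
      ‖∑ k, c k * character h (gridPoint q k)‖ = 1 := by
  choose c hc using fun j => exists_trigInterpolation_coeff (rfl : 2 * q j + 1 = 2 * q j + 1) (x j)
  -- Characters and product coefficients both factorize, so everything reduces to one coordinate.
  have hprod : ∀ h : Fin s → ℤ, ∑ k : ∀ j, Fin (2 * q j + 1),
      (∏ j, c j (k j)) * character h (gridPoint q k) =
      ∏ j, ∑ k : Fin (2 * q j + 1), c j k * Complex.exp (2 * Real.pi * Complex.I *
        ((h j : ℂ) * (((k : ℕ) : ℂ) / ((2 * q j + 1 : ℕ) : ℂ)))) := by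
    intro h
    rw [Finset.prod_univ_sum, Fintype.piFinset_univ]
    refine Finset.sum_congr rfl fun k _ => ?_
    rw [character_eq_prod, ← Finset.prod_mul_distrib]
    simp [gridPoint]
  refine ⟨fun k => ∏ j, c j (k j), fun h => ⟨fun hh => ?_, ?_⟩⟩
  · rw [hprod, character_eq_prod]
    exact Finset.prod_congr rfl fun j _ => (hc j (h j)).1 (hh j)
  · rw [hprod, norm_prod]
    exact Finset.prod_eq_one fun j _ => (hc j (h j)).2

variable (w : KorobovWeights)

/-! ### Functions in the Korobov space that vanish on a grid -/

theorem hasSum_kernel {s : ℕ} (hs : Summable fun h : Fin s → ℤ => w.omega h) (x y : UnitCube s) :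
    HasSum (fun h : Fin s → ℤ =>
      (w.omega h : ℂ) * (character h x * (starRingEnd ℂ) (character h y))) (w.kernel x y) := by
  have : Summable fun h : Fin s → ℤ => (w.omega h : ℂ) *
      Complex.exp (2 * Real.pi * Complex.I *
        ∑ j, (h j : ℂ) * (((x j : ℝ) : ℂ) - ((y j : ℝ) : ℂ))) := by
    refine Summable.of_norm ?_
    simpa [norm_exp_factor, abs_of_pos (w.omega_pos _)] using hs
  have h2 : HasSum _ (w.kernel x y) := this.hasSum
  simpa only [exp_factor, character] using h2

/-- The squared norm of a combination of kernel functions, in terms of the Fourier weights. -/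
theorem hasSum_norm_sq_kerFun {s : ℕ} (hs : Summable fun h : Fin s → ℤ => w.omega h)
    {ι : Type*} [Fintype ι] (y : ι → UnitCube s) (d : ι → ℂ) :
    HasSum (fun h : Fin s → ℤ => w.omega h * ‖∑ i, (starRingEnd ℂ) (d i) * character h (y i)‖ ^ 2)
      (‖∑ i, RKHS.kerFun (𝕜 := ℂ) (w.KorobovSpace s) (y i) (d i)‖ ^ 2) := by
  have h1 : HasSum (fun h : Fin s → ℤ => ∑ i, ∑ j, ((w.omega h : ℂ) *
        (character h (y i) * (starRingEnd ℂ) (character h (y j)))) * ((starRingEnd ℂ) (d i) * d j))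
      (∑ i, ∑ j, w.kernel (y i) (y j) * ((starRingEnd ℂ) (d i) * d j)) :=
    hasSum_sum fun i _ => hasSum_sum fun j _ => (w.hasSum_kernel hs _ _).mul_right _
  have h2 : (∑ i, ∑ j, w.kernel (y i) (y j) * ((starRingEnd ℂ) (d i) * d j)) =
      ((‖∑ i, RKHS.kerFun (𝕜 := ℂ) (w.KorobovSpace s) (y i) (d i)‖ ^ 2 : ℝ) : ℂ) := by
    have := inner_self_eq_norm_sq_to_K (𝕜 := ℂ)
      (∑ i, RKHS.kerFun (𝕜 := ℂ) (w.KorobovSpace s) (y i) (d i))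
    simp only [sum_inner, inner_sum] at this
    simp only [← RKHS.kernel_inner, RKHS.OfKernel.kernel_ofKernel] at this
    push_cast
    refine Eq.trans ?_ this
    rw [Finset.sum_comm]
    refine Finset.sum_congr rfl fun i _ => Finset.sum_congr rfl fun j _ => ?_
    simp [kernelMatrix, w.conj_kernel]
    ring
  have h3 : HasSum (fun h : Fin s → ℤ =>
      ((w.omega h * ‖∑ i, (starRingEnd ℂ) (d i) * character h (y i)‖ ^ 2 : ℝ) : ℂ))
      ((‖∑ i, RKHS.kerFun (𝕜 := ℂ) (w.KorobovSpace s) (y i) (d i)‖ ^ 2 : ℝ) : ℂ) := by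
    rw [← h2]
    convert h1 using 1
    funext h
    rw [Complex.ofReal_mul, Complex.ofReal_pow, ← Complex.mul_conj']
    simp only [map_sum, map_mul, Complex.conj_conj]
    rw [Finset.sum_mul_sum]
    simp only [Finset.mul_sum]
    refine Finset.sum_congr rfl fun i _ => Finset.sum_congr rfl fun j _ => ?_
    ring
  exact_mod_cast h3

/-- A function that vanishes on a regular grid is controlled by the Fourier weights outside
the box of frequencies that the grid resolves. -/
theorem norm_apply_sq_le_of_eq_zero {s : ℕ} (hs : Summable fun h : Fin s → ℤ => w.omega h)
    (q : Fin s → ℕ) (g : w.KorobovSpace s) (hg : ∀ x ∈ regularGrid fun j => 2 * q j + 1, g x = 0)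
    {F : (Fin s → ℤ) → ℝ} (hF : Summable F) (hF0 : ∀ h, 0 ≤ F h)
    (hωF : ∀ h : Fin s → ℤ, (∃ j, (q j : ℤ) < |h j|) → w.omega h ≤ F h) (x : UnitCube s) :
    ‖g x‖ ^ 2 ≤ ‖g‖ ^ 2 * (4 * ∑' h, F h) := by
  obtain ⟨c, hc⟩ := exists_gridInterpolation_coeff q x
  let y : Option (∀ j, Fin (2 * q j + 1)) → UnitCube s := fun i => i.elim x (gridPoint q)
  -- `none` is the point `x`, `some k` a grid point. The conjugate compensates for the
  -- conjugate-linear first slot of the inner product.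
  let d : Option (∀ j, Fin (2 * q j + 1)) → ℂ := fun i => i.elim 1 fun k => -(starRingEnd ℂ) (c k)
  let v : w.KorobovSpace s := ∑ i, RKHS.kerFun (𝕜 := ℂ) (w.KorobovSpace s) (y i) (d i)
  have hinner : ⟪v, g⟫_ℂ = g x := by
    have hzero : ∀ k, g (gridPoint q k) = 0 := fun k => hg _ (gridPoint_mem q k)
    simp only [v]
    rw [sum_inner, Fintype.sum_option]
    simp only [RKHS.kerFun_inner]
    simp [y, d, hzero]
  have hv : ‖v‖ ^ 2 ≤ 4 * ∑' h, F h := by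
    have h1 := w.hasSum_norm_sq_kerFun hs y d
    rw [← tsum_mul_left, ← h1.tsum_eq]
    refine h1.summable.tsum_le_tsum (fun h => ?_) (hF.mul_left 4)
    have hsum : ∑ i, (starRingEnd ℂ) (d i) * character h (y i) =
        character h x - ∑ k, c k * character h (gridPoint q k) := by
      simp [Fintype.sum_option, d, y, sub_eq_add_neg]
    rw [hsum]
    by_cases hh : ∀ j, |h j| ≤ q j
    · rw [(hc h).1 hh]
      simpa using hF0 h
    · push Not at hh
      have hle : ‖character h x - ∑ k, c k * character h (gridPoint q k)‖ ≤ 2 := by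
        refine (norm_sub_le _ _).trans ?_
        rw [norm_character, (hc h).2]
        norm_num
      calc w.omega h * ‖character h x - ∑ k, c k * character h (gridPoint q k)‖ ^ 2
          ≤ F h * 2 ^ 2 := by
            gcongr
            · exact hF0 h
            · exact hωF h hh
        _ = 4 * F h := by ring
  calc ‖g x‖ ^ 2 ≤ (‖v‖ * ‖g‖) ^ 2 := by
        rw [← hinner]
        gcongr
        exact norm_inner_le_norm v g
    _ = ‖g‖ ^ 2 * ‖v‖ ^ 2 := by ring
    _ ≤ _ := by gcongr

end KorobovWeights
-- Dimension-independent summability of the Fourier weights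
/-- Sums of products over `ℤ^s` factorize, as an upper bound for nonnegative factors whose
finite sums are bounded. -/
theorem summable_prod_and_tsum_le {ι α : Type*} [Fintype ι] [DecidableEq ι] [DecidableEq α]
    {f : ι → α → ℝ} (hf : ∀ i a, 0 ≤ f i a) {S : ι → ℝ}
    (hS : ∀ i (F : Finset α), ∑ a ∈ F, f i a ≤ S i) :
    (Summable fun h : ι → α => ∏ i, f i (h i)) ∧ ∑' h : ι → α, ∏ i, f i (h i) ≤ ∏ i, S i := by
  have hnn : ∀ h : ι → α, 0 ≤ ∏ i, f i (h i) := fun h => Finset.prod_nonneg fun i _ => hf i _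
  have hbound : ∀ F : Finset (ι → α), ∑ h ∈ F, ∏ i, f i (h i) ≤ ∏ i, S i := by
    intro F
    calc ∑ h ∈ F, ∏ i, f i (h i)
        ≤ ∑ h ∈ Fintype.piFinset fun i => F.image fun h => h i, ∏ i, f i (h i) := by
          refine Finset.sum_le_sum_of_subset_of_nonneg (fun h hh => ?_) fun h _ _ => hnn h
          rw [Fintype.mem_piFinset]
          exact fun i => Finset.mem_image_of_mem (fun h : ι → α => h i) hh
      _ = ∏ i, ∑ a ∈ F.image fun h => h i, f i a := by rw [Finset.prod_univ_sum]
      _ ≤ ∏ i, S i := Finset.prod_le_prod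
          (fun i _ => Finset.sum_nonneg fun a _ => hf i a) fun i _ => hS i _
  exact ⟨summable_of_sum_le hnn hbound, Real.tsum_le_of_sum_le hnn hbound⟩

namespace KorobovWeights

variable (w : KorobovWeights)

theorem aStar_le (j : ℕ) : w.aStar ≤ w.a j :=
  ciInf_le ⟨0, by rintro _ ⟨i, rfl⟩; exact (w.a_pos i).le⟩ j

theorem aStar_pos : 0 < w.aStar := w.a_inf_pos

theorem iInf_b_le (j : ℕ) : ⨅ i, w.b i ≤ w.b j :=
  ciInf_le ⟨0, by rintro _ ⟨i, rfl⟩; exact (w.b_pos i).le⟩ j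

theorem log_inv_ω_pos : 0 < Real.log w.ω⁻¹ :=
  Real.log_pos ((one_lt_inv₀ w.ω_pos).2 w.ω_lt_one)

theorem exists_exp_le_a {δ : ℝ} (hδ : (δ : EReal) < w.alphaStar) :
    ∃ N : ℕ, ∀ j, N ≤ j → Real.exp (δ * ((j : ℝ) + 1)) ≤ w.a j := by
  have h := eventually_lt_of_lt_liminf hδ
  obtain ⟨N, hN⟩ := eventually_atTop.1 h
  refine ⟨N, fun j hj => ?_⟩
  have h1 : δ < Real.log (w.a j) / ((j : ℝ) + 1) := by exact_mod_cast hN j hj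
  rw [← Real.le_log_iff_exp_le (w.a_pos j)]
  exact ((lt_div_iff₀ (by positivity)).1 h1).le

/-- A positive `α^*` makes `a_j` grow at least geometrically, which gives a geometric majorant. -/
theorem summable_inv_a_pow (hα : 0 < w.alphaStar) {N : ℕ} (hN : N ≠ 0) :
    Summable fun j => (w.a j ^ N)⁻¹ := by
  obtain ⟨δ, hδ0, hδ⟩ := EReal.lt_iff_exists_real_btwn.1 hα
  have hδ0 : 0 < δ := by exact_mod_cast hδ0
  obtain ⟨M, hM⟩ := w.exists_exp_le_a hδ
  have hgeo : Summable fun j : ℕ => Real.exp (-δ) ^ j :=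
    summable_geometric_of_lt_one (Real.exp_pos _).le (by rw [Real.exp_lt_one_iff]; linarith)
  refine Summable.of_norm_bounded_eventually_nat hgeo ?_
  filter_upwards [eventually_ge_atTop M] with j hj
  have hj1 : 1 ≤ w.a j := (Real.one_le_exp (by positivity)).trans (hM j hj)
  rw [Real.norm_of_nonneg (inv_nonneg.2 (pow_nonneg (w.a_pos j).le N)), ← Real.exp_nat_mul,
    mul_neg, Real.exp_neg]
  refine inv_anti₀ (Real.exp_pos _) ?_
  calc Real.exp (j * δ) ≤ Real.exp (δ * ((j : ℝ) + 1)) := by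
        refine Real.exp_le_exp.2 ?_
        nlinarith
    _ ≤ w.a j := hM j hj
    _ ≤ w.a j ^ N := le_self_pow₀ hj1 hN

/-- The powers of the Fourier weights are summable, with a bound that is uniform in the
dimension. -/
theorem exists_tsum_omega_rpow_le (hα : 0 < w.alphaStar) {θ : ℝ} (hθ : 0 < θ) :
    ∃ M : ℝ, ∀ s : ℕ, (Summable fun h : Fin s → ℤ => w.omega h ^ θ) ∧
      ∑' h : Fin s → ℤ, w.omega h ^ θ ≤ M := by
  set c := θ * Real.log w.ω⁻¹ with hc
  have hc0 : 0 < c := mul_pos hθ w.log_inv_ω_pos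
  -- `N` is chosen so that `N b_j ≥ 2` for all `j`: bounding `exp (-u)` by `N! / u ^ N` then gives
  -- decay `1 / k ^ 2` in the frequency and `a_j ^ (-N)` in the weight.
  obtain ⟨N, hN⟩ := exists_nat_ge (2 / ⨅ i, w.b i)
  have hNb : 2 ≤ N * ⨅ i, w.b i := (div_le_iff₀ w.b_inf_pos).1 hN
  have hN0 : N ≠ 0 := by
    rintro rfl
    norm_num at hNb
  let f : ℕ → ℤ → ℝ := fun j k => Real.exp (-(c * (w.a j * |(k : ℝ)| ^ w.b j)))
  have hf0 : ∀ j k, 0 ≤ f j k := fun j k => (Real.exp_pos _).le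
  have homega : ∀ (s : ℕ) (h : Fin s → ℤ), w.omega h ^ θ = ∏ j : Fin s, f j (h j) := by
    intro s h
    rw [omega, ← Real.rpow_mul w.ω_pos.le, Real.rpow_def_of_pos w.ω_pos, ← Real.exp_sum,
      Finset.sum_neg_distrib, ← Finset.mul_sum, hc, Real.log_inv]
    congr 1
    ring
  have hfle : ∀ j k, f j k ≤ (if k = 0 then 1 else 0) +
      N.factorial / c ^ N * (w.a j ^ N)⁻¹ * (1 / (k : ℝ) ^ 2) := by
    intro j k
    have ha := w.a_pos j
    by_cases hk : k = 0
    · simp [hk, f, Real.zero_rpow (w.b_pos j).ne']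
    · have hk1 : (1 : ℝ) ≤ |(k : ℝ)| := by exact_mod_cast Int.one_le_abs hk
      set z := |(k : ℝ)| ^ w.b j with hz
      have hz0 : 0 < z := Real.rpow_pos_of_pos (by linarith) _
      have hz2 : (k : ℝ) ^ 2 ≤ z ^ N := by
        rw [← sq_abs, hz, ← Real.rpow_natCast, ← Real.rpow_natCast, ← Real.rpow_mul (abs_nonneg _)]
        refine Real.rpow_le_rpow_of_exponent_le hk1 ?_
        have : (N : ℝ) * ⨅ i, w.b i ≤ N * w.b j := by
          gcongr
          exact w.iInf_b_le j
        push_cast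
        linarith
      have hk2 : 0 < (k : ℝ) ^ 2 := by positivity
      have hexp := Real.pow_div_factorial_le_exp (x := c * (w.a j * z)) (by positivity) N
      have hfac : (0 : ℝ) < N.factorial := by exact_mod_cast N.factorial_pos
      simp only [f, hk, if_false, zero_add, ← hz]
      rw [Real.exp_neg]
      calc (Real.exp (c * (w.a j * z)))⁻¹ ≤ ((c * (w.a j * z)) ^ N / N.factorial)⁻¹ :=
            inv_anti₀ (by positivity) hexp
        _ = N.factorial / c ^ N * (w.a j ^ N)⁻¹ * (1 / z ^ N) := by
            rw [mul_pow c, mul_pow (w.a j), inv_div, ← mul_assoc, ← div_div, ← div_div,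
              ← div_eq_mul_inv, mul_one_div]
        _ ≤ _ := by gcongr
  have hsq : Summable fun k : ℤ => 1 / (k : ℝ) ^ 2 := Real.summable_one_div_int_pow.2 one_lt_two
  set D := N.factorial / c ^ N * ∑' k : ℤ, 1 / (k : ℝ) ^ 2 with hD
  have hD0 : 0 ≤ D := mul_nonneg (by positivity) (tsum_nonneg fun k => by positivity)
  have hu := (w.summable_inv_a_pow hα hN0).mul_left D
  have hu0 : ∀ j, 0 ≤ D * (w.a j ^ N)⁻¹ := fun j =>
    mul_nonneg hD0 (inv_nonneg.2 (pow_nonneg (w.a_pos j).le N))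
  -- The frequency 0 contributes exactly the 1; the excess is summable in `j`, so the product over
  -- all coordinates stays bounded.
  have hSf : ∀ (j : ℕ) (F : Finset ℤ), ∑ k ∈ F, f j k ≤ 1 + D * (w.a j ^ N)⁻¹ := by
    intro j F
    have ha := w.a_pos j
    refine (Finset.sum_le_sum fun k _ => hfle j k).trans ?_
    rw [Finset.sum_add_distrib, ← Finset.mul_sum]
    refine add_le_add ?_ ?_
    · rw [Finset.sum_ite_eq']
      split_ifs <;> norm_num
    · calc N.factorial / c ^ N * (w.a j ^ N)⁻¹ * ∑ k ∈ F, 1 / (k : ℝ) ^ 2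
          ≤ N.factorial / c ^ N * (w.a j ^ N)⁻¹ * ∑' k : ℤ, 1 / (k : ℝ) ^ 2 := by
            gcongr
            exact hsq.sum_le_tsum F fun k _ => by positivity
        _ = D * (w.a j ^ N)⁻¹ := by rw [hD]; ring
  refine ⟨Real.exp (∑' j, D * (w.a j ^ N)⁻¹), fun s => ?_⟩
  simp only [homega]
  obtain ⟨h1, h2⟩ := summable_prod_and_tsum_le (fun (j : Fin s) k => hf0 j k)
    fun (j : Fin s) F => hSf j F
  refine ⟨h1, h2.trans ((Real.prod_one_add_le_exp_sum Finset.univ fun j : Fin s => hu0 j).trans ?_)⟩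
  gcongr
  rw [Fin.sum_univ_eq_sum_range fun j => D * (w.a j ^ N)⁻¹]
  exact hu.sum_le_tsum _ fun j _ => hu0 j

/-! ### The error bound for the chosen mesh -/

/-- The order `⌈(log ε⁻² / (a_j ^ β log ω⁻¹)) ^ (1 / b_j)⌉ - 1` of trigonometric interpolation
that belongs to the mesh-size `m_j`. -/
noncomputable def order (β ε : ℝ) (j : ℕ) : ℕ :=
  ⌈(Real.log (ε ^ (-2 : ℤ)) / (w.a j ^ β * Real.log w.ω⁻¹)) ^ (1 / w.b j)⌉₊ - 1

theorem log_zpow_neg_two (ε : ℝ) : Real.log (ε ^ (-2 : ℤ)) = 2 * Real.log ε⁻¹ := by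
  rw [Real.log_zpow, Real.log_inv]
  push_cast
  ring

theorem log_inv_pos {ε : ℝ} (hε : ε ∈ Set.Ioo (0 : ℝ) 1) : 0 < Real.log ε⁻¹ :=
  Real.log_pos ((one_lt_inv₀ hε.1).2 hε.2)

theorem mesh_base_pos (β : ℝ) {ε : ℝ} (hε : ε ∈ Set.Ioo (0 : ℝ) 1) (j : ℕ) :
    0 < Real.log (ε ^ (-2 : ℤ)) / (w.a j ^ β * Real.log w.ω⁻¹) := by
  have h1 := log_inv_pos hε
  have h2 := w.log_inv_ω_pos
  have h3 := Real.rpow_pos_of_pos (w.a_pos j) β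
  rw [log_zpow_neg_two]
  positivity

theorem mesh_eq (β : ℝ) {ε : ℝ} (hε : ε ∈ Set.Ioo (0 : ℝ) 1) (j : ℕ) :
    w.mesh β ε j = 2 * w.order β ε j + 1 := by
  have := Nat.ceil_pos.2 (Real.rpow_pos_of_pos (w.mesh_base_pos β hε j) (1 / w.b j))
  unfold mesh order
  omega

/-- Frequencies that the grid does not resolve have small Fourier weights. -/
theorem omega_le_of_order_lt {β ε θ : ℝ} (hβ : β ∈ Set.Ioo (0 : ℝ) 1)
    (hε : ε ∈ Set.Ioo (0 : ℝ) 1) (hθ : θ < 1) {s : ℕ} {h : Fin s → ℤ}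
    (hh : ∃ j : Fin s, (w.order β ε j : ℤ) < |h j|) :
    w.omega h ≤ (ε ^ (w.aStar ^ (1 - β) * (1 - θ))) ^ 2 * w.omega h ^ θ := by
  obtain ⟨j, hj⟩ := hh
  have ha := w.a_pos j
  have hlω := w.log_inv_ω_pos
  have hbase := w.mesh_base_pos β hε j
  set y := Real.log (ε ^ (-2 : ℤ)) / (w.a j ^ β * Real.log w.ω⁻¹) with hy
  -- The order is the ceiling minus 1, so an integer frequency beyond it is at least the ceiling.
  have hle : y ^ (1 / w.b j) ≤ |(h j : ℝ)| := by
    have h1 : ⌈y ^ (1 / w.b j)⌉₊ ≤ (h j).natAbs := by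
      unfold order at hj
      rw [← hy, Int.abs_eq_natAbs] at hj
      omega
    have h2 : ((h j).natAbs : ℝ) = |(h j : ℝ)| := by rw [Nat.cast_natAbs, Int.cast_abs]
    rw [← h2]
    exact (Nat.le_ceil _).trans (by exact_mod_cast h1)
  have hle2 : y ≤ |(h j : ℝ)| ^ w.b j := by
    have := Real.rpow_le_rpow (by positivity) hle (w.b_pos j).le
    rwa [← Real.rpow_mul hbase.le, one_div_mul_cancel (w.b_pos j).ne', Real.rpow_one] at this
  have hterm : w.aStar ^ (1 - β) * (Real.log (ε ^ (-2 : ℤ)) / Real.log w.ω⁻¹) ≤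
      w.a j * |(h j : ℝ)| ^ w.b j := by
    have hL : 0 ≤ Real.log (ε ^ (-2 : ℤ)) / Real.log w.ω⁻¹ := by
      rw [log_zpow_neg_two]
      have := log_inv_pos hε
      positivity
    calc _ ≤ w.a j ^ (1 - β) * (Real.log (ε ^ (-2 : ℤ)) / Real.log w.ω⁻¹) := by
          gcongr
          · exact w.aStar_pos.le
          · linarith [hβ.2]
          · exact w.aStar_le j
      _ = w.a j * y := by
          rw [hy, Real.rpow_sub ha, Real.rpow_one]
          field_simp
      _ ≤ _ := by gcongr
  have hsum : w.aStar ^ (1 - β) * (Real.log (ε ^ (-2 : ℤ)) / Real.log w.ω⁻¹) ≤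
      ∑ i : Fin s, w.a i * |(h i : ℝ)| ^ w.b i :=
    hterm.trans (Finset.single_le_sum (f := fun i : Fin s => w.a i * |(h i : ℝ)| ^ w.b i)
      (fun i _ => mul_nonneg (w.a_pos i).le (Real.rpow_nonneg (abs_nonneg _) _))
      (Finset.mem_univ j))
  have hsmall : w.omega h ≤ ε ^ (2 * w.aStar ^ (1 - β)) := by
    refine (Real.rpow_le_rpow_of_exponent_ge w.ω_pos w.ω_lt_one.le hsum).trans_eq ?_
    rw [Real.rpow_def_of_pos w.ω_pos, Real.rpow_def_of_pos hε.1, log_zpow_neg_two]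
    rw [Real.log_inv] at hlω
    have hne : Real.log w.ω ≠ 0 := by linarith
    rw [Real.log_inv, Real.log_inv]
    congr 1
    field_simp
  have homega := w.omega_pos h
  -- The first factor supplies the power of `ε`, the second is kept for summation over `h`.
  calc w.omega h = w.omega h ^ (1 - θ) * w.omega h ^ θ := by
        rw [← Real.rpow_add homega, sub_add_cancel, Real.rpow_one]
    _ ≤ (ε ^ (2 * w.aStar ^ (1 - β))) ^ (1 - θ) * w.omega h ^ θ := by
        gcongr
    _ = _ := by
        rw [← Real.rpow_mul hε.1.le, ← Real.rpow_natCast, ← Real.rpow_mul hε.1.le]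
        congr 2
        push_cast
        ring

/-- Minimality gives the spline norm at most 1, so `f` minus its spline has norm at most 2 and
vanishes on the grid. The squared bound `2 ^ 2 * 4 * κ ^ 2 * M` produces the constant `4 * √M`. -/
theorem splineError_le {β ε θ M : ℝ} (hβ : β ∈ Set.Ioo (0 : ℝ) 1) (hε : ε ∈ Set.Ioo (0 : ℝ) 1)
    (hθ : θ < 1) {s : ℕ} (hω : Summable fun h : Fin s → ℤ => w.omega h)
    (hs : Summable fun h : Fin s → ℤ => w.omega h ^ θ) (hM : ∑' h : Fin s → ℤ, w.omega h ^ θ ≤ M) :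
    w.splineError s (w.grid β ε s) ≤
      ENNReal.ofReal (4 * √M * ε ^ (w.aStar ^ (1 - β) * (1 - θ))) := by
  have hM0 : 0 ≤ M := (tsum_nonneg fun h => Real.rpow_nonneg (w.omega_pos h).le θ).trans hM
  set κ := ε ^ (w.aStar ^ (1 - β) * (1 - θ)) with hκ
  have hκ0 : 0 ≤ κ := Real.rpow_nonneg hε.1.le _
  have hgrid : w.grid β ε s = regularGrid fun j : Fin s => 2 * w.order β ε j + 1 := by
    unfold grid
    simp only [w.mesh_eq β hε]
  refine iSup₂_le fun f hf => ?_
  rw [eLpNorm_exponent_top]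
  refine eLpNormEssSup_le_of_ae_bound (Eventually.of_forall fun x => ?_)
  obtain ⟨hint, hmin⟩ := isSpline_spline (w.grid β ε s) f
  have hg : ‖f - spline (w.grid β ε s) f‖ ≤ 2 := by
    refine (norm_sub_le _ _).trans ?_
    linarith [hmin f fun _ _ => rfl]
  have hbound := w.norm_apply_sq_le_of_eq_zero hω (fun j : Fin s => w.order β ε j)
    (f - spline (w.grid β ε s) f) (fun y hy => by simp [hint y (hgrid ▸ hy)])
    (hs.mul_left (κ ^ 2)) (fun h => mul_nonneg (sq_nonneg κ) (Real.rpow_nonneg (w.omega_pos h).le θ))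
    (fun h hh => w.omega_le_of_order_lt hβ hε hθ hh) x
  rw [RKHS.coe_sub, Pi.sub_apply, tsum_mul_left] at hbound
  refine abs_le_of_sq_le_sq' ?_ (by positivity) |>.2
  calc ‖f x - spline (w.grid β ε s) f x‖ ^ 2
      ≤ _ := hbound
    _ ≤ 2 ^ 2 * (4 * (κ ^ 2 * M)) := by
        have : 0 ≤ ∑' h : Fin s → ℤ, w.omega h ^ θ :=
          tsum_nonneg fun h => Real.rpow_nonneg (w.omega_pos h).le θ
        gcongr
    _ = (4 * √M * κ) ^ 2 := by
        rw [mul_pow, mul_pow, Real.sq_sqrt hM0]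
        ring

/-! ### The number of grid points -/

/-- The mesh-size is `1` for large weights, and otherwise at most three times the
quantity that it rounds. -/
theorem mesh_le {β ε : ℝ} (hβ : 0 ≤ β) (hε : ε ∈ Set.Ioo (0 : ℝ) 1) (j : ℕ) :
    (w.mesh β ε j : ℝ) ≤
      (if w.a j ^ β < 2 * Real.log ε⁻¹ / Real.log w.ω⁻¹ then 3 else 1) *
        max 1 (2 * Real.log ε⁻¹ / Real.log w.ω⁻¹ / w.aStar ^ β) ^ (1 / w.b j) := by
  have hbase := w.mesh_base_pos β hε j
  have hlω := w.log_inv_ω_pos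
  have hlε := log_inv_pos hε
  have hb := w.b_pos j
  have hA := Real.rpow_pos_of_pos w.aStar_pos β
  have haj := Real.rpow_pos_of_pos (w.a_pos j) β
  have heq : Real.log (ε ^ (-2 : ℤ)) / (w.a j ^ β * Real.log w.ω⁻¹) =
      2 * Real.log ε⁻¹ / Real.log w.ω⁻¹ / w.a j ^ β := by
    rw [log_zpow_neg_two]
    field_simp
  have hone : 1 ≤ max 1 (2 * Real.log ε⁻¹ / Real.log w.ω⁻¹ / w.aStar ^ β) ^ (1 / w.b j) :=
    Real.one_le_rpow (le_max_left _ _) (by positivity)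
  set y := Real.log (ε ^ (-2 : ℤ)) / (w.a j ^ β * Real.log w.ω⁻¹) with hy
  split_ifs with hlt
  · have hy1 : 1 ≤ y := by
      rw [heq, one_le_div haj]
      exact hlt.le
    have ht1 : 1 ≤ y ^ (1 / w.b j) := Real.one_le_rpow hy1 (by positivity)
    -- With `t = y ^ (1 / b_j) ≥ 1` the mesh-size is below `2 (t + 1) - 1 = 2 t + 1 ≤ 3 t`.
    have hm : (w.mesh β ε j : ℝ) + 1 = 2 * ⌈y ^ (1 / w.b j)⌉₊ := by
      have h1 := Nat.ceil_pos.2 (Real.rpow_pos_of_pos hbase (1 / w.b j))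
      have h2 : w.mesh β ε j + 1 = 2 * ⌈y ^ (1 / w.b j)⌉₊ := by
        unfold mesh
        rw [← hy]
        omega
      exact_mod_cast h2
    have hceil := Nat.ceil_lt_add_one (zero_le_one.trans ht1)
    have hle : y ^ (1 / w.b j) ≤
        max 1 (2 * Real.log ε⁻¹ / Real.log w.ω⁻¹ / w.aStar ^ β) ^ (1 / w.b j) := by
      refine Real.rpow_le_rpow hbase.le (le_max_of_le_right ?_) (by positivity)
      rw [heq]
      have haa : w.aStar ^ β ≤ w.a j ^ β := Real.rpow_le_rpow w.aStar_pos.le (w.aStar_le j) hβ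
      gcongr
    linarith
  · have hy1 : y ≤ 1 := by
      rw [heq, div_le_one haj]
      exact not_lt.1 hlt
    have hceil : ⌈y ^ (1 / w.b j)⌉₊ ≤ 1 := by
      rw [Nat.ceil_le]
      exact_mod_cast Real.rpow_le_one hbase.le hy1 (by positivity)
    have hm : w.mesh β ε j ≤ 1 := by
      unfold mesh
      rw [← hy]
      omega
    have : (w.mesh β ε j : ℝ) ≤ 1 := by exact_mod_cast hm
    linarith

/-- The number of coordinates in which the grid has more than one point. -/
theorem card_filter_rpow_lt_le {β δ : ℝ} (hβ : 0 < β) (hδ : 0 < δ) {N : ℕ}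
    (hN : ∀ j, N ≤ j → Real.exp (δ * ((j : ℝ) + 1)) ≤ w.a j) (L : ℝ) (s : ℕ) :
    (((Finset.range s).filter fun j => w.a j ^ β < L).card : ℝ) ≤
      N + Real.log (max 1 L) / (β * δ) := by
  have hlog : 0 ≤ Real.log (max 1 L) := Real.log_nonneg (le_max_left _ _)
  -- Beyond `N`, `exp (β δ (j + 1)) ≤ a_j ^ β < L` forces `j + 1 ≤ log L / (β δ)`.
  have hsub : ((Finset.range s).filter fun j => w.a j ^ β < L) ⊆
      Finset.range N ∪ Finset.range ⌊Real.log (max 1 L) / (β * δ)⌋₊ := by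
    intro j hj
    rw [Finset.mem_filter] at hj
    rw [Finset.mem_union, Finset.mem_range, Finset.mem_range, or_iff_not_imp_left, not_lt]
    intro hNj
    refine Nat.le_floor ?_
    rw [le_div_iff₀ (by positivity), Real.le_log_iff_exp_le (by positivity)]
    calc Real.exp (((j + 1 : ℕ) : ℝ) * (β * δ)) = Real.exp (δ * ((j : ℝ) + 1)) ^ β := by
          rw [← Real.exp_mul]
          congr 1
          push_cast
          ring
      _ ≤ w.a j ^ β := Real.rpow_le_rpow (Real.exp_pos _).le (hN j hNj) hβ.le
      _ ≤ max 1 L := hj.2.le.trans (le_max_right _ _)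
  have hcard := (Finset.card_le_card hsub).trans (Finset.card_union_le _ _)
  rw [Finset.card_range, Finset.card_range] at hcard
  calc _ ≤ ((N + ⌊Real.log (max 1 L) / (β * δ)⌋₊ : ℕ) : ℝ) := by exact_mod_cast hcard
    _ ≤ _ := by
        push_cast
        gcongr
        exact Nat.floor_le (by positivity)

/-- The mesh bounds are multiplied over the coordinates. The maxima with 1 keep the bases at least
1, so that partial sums of `1 / b_j` may be replaced by `B`. -/
theorem ncard_grid_le (hB : Summable fun j : ℕ => 1 / w.b j) {β δ : ℝ} (hβ : 0 < β) (hδ : 0 < δ)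
    {N : ℕ} (hN : ∀ j, N ≤ j → Real.exp (δ * ((j : ℝ) + 1)) ≤ w.a j) {ε : ℝ}
    (hε : ε ∈ Set.Ioo (0 : ℝ) 1) (s : ℕ) :
    ((w.grid β ε s).ncard : ℝ) ≤
      3 ^ N * max 1 (2 * Real.log ε⁻¹ / Real.log w.ω⁻¹) ^ (Real.log 3 / (β * δ)) *
        max 1 (2 * Real.log ε⁻¹ / Real.log w.ω⁻¹ / w.aStar ^ β) ^ w.B := by
  set L := 2 * Real.log ε⁻¹ / Real.log w.ω⁻¹ with hL
  set Λ := max 1 (L / w.aStar ^ β) with hΛ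
  have hΛ1 : 1 ≤ Λ := le_max_left _ _
  have hL1 : 0 < max 1 L := by positivity
  rw [grid, ncard_regularGrid, Fin.prod_univ_eq_prod_range (w.mesh β ε), Nat.cast_prod]
  calc ∏ j ∈ Finset.range s, (w.mesh β ε j : ℝ)
      ≤ ∏ j ∈ Finset.range s, ((if w.a j ^ β < L then 3 else 1) * Λ ^ (1 / w.b j)) :=
        Finset.prod_le_prod (fun j _ => Nat.cast_nonneg _) fun j _ => w.mesh_le hβ.le hε j
    _ = 3 ^ ((Finset.range s).filter fun j => w.a j ^ β < L).card *
          Λ ^ ∑ j ∈ Finset.range s, 1 / w.b j := by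
        rw [Finset.prod_mul_distrib, Finset.prod_ite]
        simp only [Finset.prod_const, one_pow, mul_one]
        rw [Real.rpow_sum_of_pos (by linarith)]
    _ ≤ (3 ^ N * max 1 L ^ (Real.log 3 / (β * δ))) * Λ ^ w.B := by
        gcongr
        -- Base and exponent are exchanged: `u ^ (log 3 / (β δ)) = 3 ^ (log u / (β δ))` for `u = max
        -- 1 L`.
        · rw [← Real.rpow_natCast, ← Real.rpow_natCast, Real.rpow_def_of_pos hL1,
            mul_div_left_comm, ← Real.rpow_def_of_pos three_pos, ← Real.rpow_add three_pos]
          exact Real.rpow_le_rpow_of_exponent_le (by norm_num)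
            (w.card_filter_rpow_lt_le hβ hδ hN L s)
        · exact hB.sum_le_tsum _ fun j _ => (one_div_pos.2 (w.b_pos j)).le

end KorobovWeights

/-! ### The main theorem -/

theorem proposition1 (w : KorobovWeights)
    (hB : Summable fun j : ℕ => 1 / w.b j)
    (hα : 0 < w.alphaStar)
    (β : ℝ) (hβ : β ∈ Set.Ioo (0 : ℝ) 1) :
    (∀ η ∈ Set.Ioo (0 : ℝ) (min (w.aStar ^ (1 - β)) 1),
      ∀ δ : ℝ, 0 < δ → (δ : EReal) < w.alphaStar →
        ∃ C : ℝ, 0 < C ∧ ∀ s : ℕ, 1 ≤ s → ∀ ε ∈ Set.Ioo (0 : ℝ) 1,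
          w.splineError s (w.grid β ε s) ≤
            ENNReal.ofReal (C * ε ^ (min (w.aStar ^ (1 - β)) 1 - η))) ∧
    (∀ δ : ℝ, 0 < δ → (δ : EReal) < w.alphaStar →
      ∃ C : ℝ, 0 < C ∧ ∀ s : ℕ, 1 ≤ s → ∀ ε ∈ Set.Ioo (0 : ℝ) 1,
        ((w.grid β ε s).ncard : ℝ) ≤
          C * (1 + Real.log ε⁻¹) ^ (w.B + Real.log 3 / (β * δ))) := by
  refine ⟨fun η hη δ _ _ => ?_, fun δ hδ0 hδ => ?_⟩
  · set A := w.aStar ^ (1 - β) with hA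
    have hA0 : 0 < A := Real.rpow_pos_of_pos w.aStar_pos _
    have hθ0 : 0 < η / A := div_pos hη.1 hA0
    have hθ1 : η / A < 1 := (div_lt_one hA0).2 (hη.2.trans_le (min_le_left _ _))
    obtain ⟨M, hM⟩ := w.exists_tsum_omega_rpow_le hα hθ0
    -- The exponent 1 gives summability of the weights themselves, needed to expand the kernel.
    obtain ⟨_, hM1⟩ := w.exists_tsum_omega_rpow_le hα one_pos
    -- The summand 1 only makes the constant positive.
    refine ⟨4 * √M + 1, by positivity, fun s _ ε hε => ?_⟩
    refine (w.splineError_le hβ hε hθ1 (by simpa using (hM1 s).1) (hM s).1 (hM s).2).trans ?_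
    refine ENNReal.ofReal_le_ofReal ?_
    have hexp : A * (1 - η / A) = A - η := by
      field_simp
    rw [← hA, hexp]
    have := hε.1
    gcongr ?_ * ?_
    · linarith
    -- The rate `A - η` was obtained; as `ε < 1`, it implies the one with `min A 1`.
    · exact Real.rpow_le_rpow_of_exponent_ge hε.1 hε.2.le
        (sub_le_sub_right (min_le_left _ _) η)
  · obtain ⟨N, hN⟩ := w.exists_exp_le_a hδ
    have hβ0 := hβ.1
    have hlω := w.log_inv_ω_pos
    have hAβ := Real.rpow_pos_of_pos w.aStar_pos β
    -- `κ` and `κ'` absorb the fixed data, so that both bases become multiples of `1 + log ε⁻¹` and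
    -- the two exponents add up.
    set κ := max 1 (2 / Real.log w.ω⁻¹) with hκ
    set κ' := max 1 (2 / Real.log w.ω⁻¹ / w.aStar ^ β) with hκ'
    have hκ1 : 1 ≤ κ := le_max_left _ _
    have hκ1' : 1 ≤ κ' := le_max_left _ _
    have hB0 : 0 ≤ w.B := tsum_nonneg fun j => (one_div_pos.2 (w.b_pos j)).le
    have hlog3 : 0 ≤ Real.log 3 / (β * δ) :=
      div_nonneg (Real.log_nonneg (by norm_num)) (by positivity)
    refine ⟨3 ^ N * κ ^ (Real.log 3 / (β * δ)) * κ' ^ w.B, by positivity, fun s _ ε hε => ?_⟩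
    have hlε := KorobovWeights.log_inv_pos hε
    have hT : 1 ≤ 1 + Real.log ε⁻¹ := by linarith
    have hle : max 1 (2 * Real.log ε⁻¹ / Real.log w.ω⁻¹) ≤ κ * (1 + Real.log ε⁻¹) := by
      refine max_le (one_le_mul_of_one_le_of_one_le hκ1 hT) ?_
      rw [mul_div_right_comm]
      gcongr
      · exact le_max_right _ _
      · linarith
    have hle' : max 1 (2 * Real.log ε⁻¹ / Real.log w.ω⁻¹ / w.aStar ^ β) ≤
        κ' * (1 + Real.log ε⁻¹) := by
      refine max_le (one_le_mul_of_one_le_of_one_le hκ1' hT) ?_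
      rw [mul_div_right_comm, mul_div_right_comm]
      gcongr
      · exact le_max_right _ _
      · linarith
    refine (w.ncard_grid_le hB hβ0 hδ0 hN hε s).trans ?_
    calc _ ≤ 3 ^ N * (κ * (1 + Real.log ε⁻¹)) ^ (Real.log 3 / (β * δ)) *
          (κ' * (1 + Real.log ε⁻¹)) ^ w.B := by gcongr
      _ = _ := by
          rw [Real.mul_rpow (by positivity) (by positivity),
            Real.mul_rpow (by positivity) (by positivity), Real.rpow_add (by positivity)]
          ring
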